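/- Let $S$ be a semigroup. An $S$-module is an abelian group $A$ with a left action of $S$ by additive endomorphisms, i.e. $s(a+b)=sa+sb$ and $s(ta)=(st)a$. Let $C^n(S,A)$ be the group of all maps $S^n\to A$ (so $C^0(S,A)=A$), and let $\partial^n:C^n(S,A)\to C^{n+1}(S,A)$ be given by $$\partial^nf(x_1,\dots,x_{n+1})=x_1f(x_2,\dots,x_{n+1})+\sum_{i=1}^n(-1)^if(x_1,\dots,x_ix_{i+1},\dots,x_{n+1})+(-1)^{n+1}f(x_1,\dots,x_n).$$ Put $H^n(S,A)=\operatorname{Ker}\partial^n/\operatorname{Im}\partial^{n-1}$ (with $\operatorname{Im}\partial^{-1}=0$). The cohomological dimension of $S$ is the largest $n$ such that $H^n(S,A)\neq0$ for some $S$-module $A$ (and $\infty$ if there is no largest such $n$). **Proposition 6.** Let $F$ be a free semigroup (without identity) of rank at least $2$, i.e. a free semigroup that is not commutative, let $w\in F$, and let $R=wF^1=\{w\}\cup wF$ be the principal right ideal generated by $w$. Then the semigroup $R$ has cohomological dimension $1$ if and only if $R$ is a free semigroup. -/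

import Mathlib

universe u

namespace SemigroupCohomology

/-- The group `Cⁿ(S, A)` of `n`-cochains: all maps from `n`-tuples of elements of `S` to `A`. -/
abbrev Cochain (S A : Type*) (n : ℕ) : Type _ := (Fin n → S) → A

section

variable {S A : Type*} [Semigroup S] [AddCommGroup A]

/-- The coboundary homomorphism `∂ⁿ : Cⁿ(S, A) → Cⁿ⁺¹(S, A)`. A (left) `S`-module is an abelian
group `A` with a multiplicative map `ρ` from `S` to the endomorphisms of `A`, where
`ρ s a` is the product `s a`. For `i : Fin n`, the tuple
`Fin.contractNth i.castSucc (· * ·) x` is `(x₀, …, xᵢ xᵢ₊₁, …, xₙ)`. -/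
def coboundary (ρ : S →ₙ* AddMonoid.End A) (n : ℕ) : Cochain S A n →+ Cochain S A (n + 1) where
  toFun f x :=
    ρ (x 0) (f (fun i => x i.succ))
      + ∑ i : Fin n, (-1 : ℤ) ^ ((i : ℕ) + 1) • f (Fin.contractNth i.castSucc (· * ·) x)
      + (-1 : ℤ) ^ (n + 1) • f (fun i => x i.castSucc)
  map_zero' := by
    funext x
    simp
  map_add' f g := by
    funext x
    simp only [Pi.add_apply, map_add, smul_add, Finset.sum_add_distrib]
    abel

/-- The group `Zⁿ(S, A)` of cocycles. -/
def cocycles (ρ : S →ₙ* AddMonoid.End A) (n : ℕ) : AddSubgroup (Cochain S A n) :=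
  (coboundary ρ n).ker

/-- The group `Bⁿ(S, A)` of coboundaries, with `B⁰(S, A) = 0`. -/
def coboundaries (ρ : S →ₙ* AddMonoid.End A) : (n : ℕ) → AddSubgroup (Cochain S A n)
  | 0 => ⊥
  | n + 1 => (coboundary ρ n).range

/-- The cohomology group `Hⁿ(S, A) = Zⁿ(S, A) / Bⁿ(S, A)`. -/
abbrev Cohomology (ρ : S →ₙ* AddMonoid.End A) (n : ℕ) : Type _ :=
  cocycles ρ n ⧸ (coboundaries ρ n).addSubgroupOf (cocycles ρ n)

end

/-- The cohomological dimension of a semigroup: the largest `n` such that `Hⁿ(S, A) ≠ 0` for some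
`S`-module `A` (it is `⊤` if there is no largest one). -/
noncomputable def cohomologicalDimension (S : Type u) [Semigroup S] : ℕ∞ :=
  ⨆ (n : ℕ) (_ : ∃ (A : Type u) (_ : AddCommGroup A) (ρ : S →ₙ* AddMonoid.End A),
    Nontrivial (Cohomology ρ n)), (n : ℕ∞)

/-- A semigroup is free if it is isomorphic to the free semigroup on some set. -/
def IsFreeSemigroup (S : Type u) [Semigroup S] : Prop :=
  ∃ β : Type u, Nonempty (S ≃* FreeSemigroup β)

/-- The principal right ideal `w F¹ = {w} ∪ w F` of a semigroup `F`, as a subsemigroup. -/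
def principalRightIdeal {F : Type*} [Semigroup F] (w : F) : Subsemigroup F where
  carrier := {x | x = w ∨ ∃ y, x = w * y}
  mul_mem' := by
    rintro a b (rfl | ⟨y, rfl⟩) _
    · exact Or.inr ⟨b, rfl⟩
    · exact Or.inr ⟨y * b, mul_assoc _ _ _⟩

end SemigroupCohomology

namespace SemigroupCohomology

/-! Everything turns on whether `w` overlaps itself: `w * c = d * w` with `d` shorter than `w`. If
it does not, then `y` and `u * y` in `R` force `u` into `R`, so `R` inherits from `F` the common
refinement of factorizations and is free (`isFreeSemigroup_principalRightIdeal`). If it does, `R`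
has two relations between `w` and `w * d` that no free semigroup allows, and they detect a nonzero
class in `H²(R, ℤ[R])` (`nontrivial_cohomology_two`); so dimension 1 excludes overlaps. Conversely,
over a free semigroup a cocycle of degree at least 2 can be normalized to vanish when its first
argument is a generator, and is then zero; word length gives a nonzero class in degree 1. -/

/-! ### The coboundary and dimension shifting -/

theorem contractNth_zero_cons_cons {S : Type*} {n : ℕ} (op : S → S → S) (s t : S) (x : Fin n → S) :
    Fin.contractNth 0 op (Fin.cons s (Fin.cons t x : Fin (n + 1) → S)) =
      (Fin.cons (op s t) x : Fin (n + 1) → S) := by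
  funext i
  refine Fin.cases ?_ (fun i => ?_) i <;> simp [Fin.contractNth]

theorem contractNth_succ_cons {S : Type*} {n : ℕ} (op : S → S → S) (j : Fin (n + 1)) (s : S)
    (x : Fin (n + 1) → S) :
    Fin.contractNth j.succ op (Fin.cons s x : Fin (n + 2) → S) =
      (Fin.cons s (Fin.contractNth j op x) : Fin (n + 1) → S) := by
  funext i
  refine Fin.cases ?_ (fun i => ?_) i <;> simp [Fin.contractNth]

section

variable {S A : Type*} [Semigroup S] [AddCommGroup A]

theorem nontrivial_cohomology_succ_iff (ρ : S →ₙ* AddMonoid.End A) (n : ℕ) :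
    Nontrivial (Cohomology ρ (n + 1)) ↔
      ∃ f : Cochain S A (n + 1), coboundary ρ (n + 1) f = 0 ∧ ∀ g, coboundary ρ n g ≠ f := by
  rw [← not_subsingleton_iff_nontrivial, QuotientAddGroup.subsingleton_iff,
    AddSubgroup.addSubgroupOf_eq_top]
  simp [SetLike.le_def, cocycles, coboundaries, AddMonoidHom.mem_ker, AddMonoidHom.mem_range]

/-- The `S`-module of all functions `S → A`, where `s` sends `φ` to `t ↦ φ (t * s)`. -/
def translation (S A : Type*) [Semigroup S] [AddCommGroup A] :
    S →ₙ* AddMonoid.End (S → A) where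
  toFun s :=
    { toFun := fun φ t => φ (t * s)
      map_zero' := rfl
      map_add' := fun _ _ => rfl }
  map_mul' s t := by
    ext φ r
    exact congrArg φ (mul_assoc r s t).symm

@[simp]
theorem translation_apply (s t : S) (φ : S → A) : translation S A s φ t = φ (t * s) := rfl

/-- A cochain as a function of its first argument. -/
def curryFirst {n : ℕ} (f : Cochain S A (n + 1)) : Cochain S (S → A) n :=
  fun x s => f (Fin.cons s x)

/-- Dimension shifting: inductions on the degree can use this in place of the alternating sum. -/
theorem coboundary_cons (ρ : S →ₙ* AddMonoid.End A) {n : ℕ} (f : Cochain S A (n + 1)) (s : S)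
    (x : Fin (n + 1) → S) :
    coboundary ρ (n + 1) f (Fin.cons s x) =
      ρ s (f x) - coboundary (translation S A) n (curryFirst f) x s := by
  have hx : x = Fin.cons (x 0) (fun i => x i.succ) := by
    funext i
    refine Fin.cases rfl (fun i => rfl) i
  have h0 : Fin.contractNth 0 (· * ·) (Fin.cons s x : Fin (n + 2) → S) =
      (Fin.cons (s * x 0) (fun i => x i.succ) : Fin (n + 1) → S) := by
    conv_lhs => rw [hx]
    exact contractNth_zero_cons_cons _ _ _ _
  have hl : (fun i : Fin (n + 1) => (Fin.cons s x : Fin (n + 2) → S) i.castSucc) =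
      (Fin.cons s (fun i => x i.castSucc) : Fin (n + 1) → S) := by
    funext i
    refine Fin.cases rfl (fun i => ?_) i
    simp
  simp only [coboundary, AddMonoidHom.coe_mk, ZeroHom.coe_mk, Fin.cons_zero, Fin.cons_succ,
    Fin.sum_univ_succ, Fin.castSucc_zero, h0, hl, ← Fin.succ_castSucc, contractNth_succ_cons,
    Pi.add_apply, translation_apply, curryFirst, Fin.val_zero,
    Fin.val_succ, pow_succ, mul_neg, mul_one, neg_smul, Finset.sum_neg_distrib]
  simp [curryFirst]
  abel

/-- All faces but the first two keep `s` as first entry, so `f` kills them. -/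
theorem coboundary_cons_cons_of_forall_cons_eq_zero (ρ : S →ₙ* AddMonoid.End A) {n : ℕ}
    {f : Cochain S A (n + 1)} {s : S} (hf : ∀ x, f (Fin.cons s x) = 0) (t : S) (x : Fin n → S) :
    coboundary ρ (n + 1) f (Fin.cons s (Fin.cons t x : Fin (n + 1) → S)) =
      ρ s (f (Fin.cons t x)) - f (Fin.cons (s * t) x) := by
  rw [coboundary_cons]
  simp [coboundary, curryFirst, hf]

theorem coboundary_coboundary_zero (ρ : S →ₙ* AddMonoid.End A) (f : Cochain S A 0) :
    coboundary ρ 1 (coboundary ρ 0 f) = 0 := by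
  funext x
  simp [coboundary, Fin.contractNth, Subsingleton.elim _ (default : Fin 0 → S)]
  abel

end

theorem coboundary_postcomp {S A B : Type*} [Semigroup S] [AddCommGroup A] [AddCommGroup B]
    {ρ : S →ₙ* AddMonoid.End A} {σ : S →ₙ* AddMonoid.End B} (φ : A →+ B)
    (hφ : ∀ s a, φ (ρ s a) = σ s (φ a)) {n : ℕ} (f : Cochain S A n) (x : Fin (n + 1) → S) :
    coboundary σ n (fun y => φ (f y)) x = φ (coboundary ρ n f x) := by
  simp [coboundary, hφ, map_sum, map_zsmul]

/-- The homomorphism of `S`-modules that sends `a` to the orbit map `s ↦ s a`. -/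
def orbitHom {S A : Type*} [Semigroup S] [AddCommGroup A] (ρ : S →ₙ* AddMonoid.End A) :
    A →+ (S → A) where
  toFun a s := ρ s a
  map_zero' := by
    funext s
    simp
  map_add' a b := by
    funext s
    simp

/-- The induction passes from `A` to the module `S → A`, which is why `A` is generalized and shares
the universe of `S`. -/
theorem coboundary_coboundary {S A : Type u} [Semigroup S] [AddCommGroup A]
    (ρ : S →ₙ* AddMonoid.End A) (n : ℕ) (f : Cochain S A n) :
    coboundary ρ (n + 1) (coboundary ρ n f) = 0 := by
  induction n generalizing A with
  | zero => exact coboundary_coboundary_zero ρ f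
  | succ n ih =>
    have hcurry : curryFirst (coboundary ρ (n + 1) f) =
        (fun x => orbitHom ρ (f x)) - coboundary (translation S A) n (curryFirst f) := by
      funext x s
      simp [curryFirst, coboundary_cons, orbitHom]
    funext x
    rw [← Fin.cons_self_tail x, coboundary_cons, hcurry, map_sub, ih, sub_zero,
      coboundary_postcomp (ρ := ρ) (orbitHom ρ) (fun s a => ?_)]
    · simp [orbitHom]
    · funext t
      simp [orbitHom]

theorem coboundary_precomp {S T A : Type*} [Semigroup S] [Semigroup T] [AddCommGroup A]
    (ρ : T →ₙ* AddMonoid.End A) (e : S →ₙ* T) {n : ℕ} (f : Cochain T A n) :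
    coboundary (ρ.comp e) n (fun x => f (e ∘ x)) = fun x => coboundary ρ n f (e ∘ x) := by
  funext x
  simp only [coboundary, AddMonoidHom.coe_mk, ZeroHom.coe_mk, MulHom.comp_apply,
    Function.comp_apply, Fin.comp_contractNth (· * ·) (· * ·) (map_mul e)]
  rfl

/-! ### Cohomology of free semigroups -/

/-- The primitive, normalized on generators, of a cocycle on a free semigroup. -/
def freePrimitive {α A : Type*} [AddCommGroup A] (ρ : FreeSemigroup α →ₙ* AddMonoid.End A)
    {n : ℕ} (f : Cochain (FreeSemigroup α) A (n + 2)) (t : Fin n → FreeSemigroup α) :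
    α → List α → A
  | _, [] => 0
  | a, b :: l => ρ (.of a) (freePrimitive ρ f t b l) -
      f (Fin.cons (.of a) (Fin.cons ⟨b, l⟩ t : Fin (n + 1) → FreeSemigroup α))

theorem exists_coboundary_eq_of_freeSemigroup {α A : Type u} [AddCommGroup A]
    (ρ : FreeSemigroup α →ₙ* AddMonoid.End A) {n : ℕ} (f : Cochain (FreeSemigroup α) A (n + 2))
    (hf : coboundary ρ (n + 2) f = 0) : ∃ g, coboundary ρ (n + 1) g = f := by
  let g : Cochain (FreeSemigroup α) A (n + 1) :=
    fun x => freePrimitive ρ f (Fin.tail x) (x 0).head (x 0).tail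
  have hg (a : α) (t : Fin n → FreeSemigroup α) : g (Fin.cons (.of a) t) = 0 := by
    simp [g, freePrimitive]
  have hg' (a : α) (y : FreeSemigroup α) (t : Fin n → FreeSemigroup α) :
      g (Fin.cons (.of a * y) t) = ρ (.of a) (g (Fin.cons y t)) -
        f (Fin.cons (.of a) (Fin.cons y t : Fin (n + 1) → FreeSemigroup α)) := by
    simp [g, freePrimitive]
  have hk (a : α) (t : Fin (n + 1) → FreeSemigroup α) :
      (f - coboundary ρ (n + 1) g) (Fin.cons (.of a) t) = 0 := by
    rw [← Fin.cons_self_tail t, Pi.sub_apply,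
      coboundary_cons_cons_of_forall_cons_eq_zero ρ (hg a), hg']
    abel
  have hdk : coboundary ρ (n + 2) (f - coboundary ρ (n + 1) g) = 0 := by
    rw [map_sub, hf, coboundary_coboundary, sub_zero]
  refine ⟨g, (sub_eq_zero.1 ?_).symm⟩
  funext x
  rw [← Fin.cons_self_tail x, Pi.zero_apply]
  generalize x 0 = s
  induction s with
  | ih1 a => exact hk a _
  | ih2 a y _ ih =>
    -- For the normalized cocycle `k = f - ∂g` the cocycle identity reads `k (a y, …) = a k (y, …)`.
    have h := congrFun hdk (Fin.cons (.of a) (Fin.cons y (Fin.tail x) : Fin (n + 2) → _))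
    rw [coboundary_cons_cons_of_forall_cons_eq_zero ρ (hk a), ih, map_zero] at h
    rwa [zero_sub, Pi.zero_apply, neg_eq_zero] at h

theorem exists_coboundary_eq_of_isFreeSemigroup {S A : Type u} [Semigroup S] [AddCommGroup A]
    (hS : IsFreeSemigroup S) (ρ : S →ₙ* AddMonoid.End A) {n : ℕ} (f : Cochain S A (n + 2))
    (hf : coboundary ρ (n + 2) f = 0) : ∃ g, coboundary ρ (n + 1) g = f := by
  obtain ⟨β, ⟨e⟩⟩ := hS
  let i : FreeSemigroup β →ₙ* S := e.symm
  obtain ⟨g, hg⟩ := exists_coboundary_eq_of_freeSemigroup (ρ.comp i) (fun x => f (i ∘ x)) (by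
    rw [coboundary_precomp, hf]
    rfl)
  let j : S →ₙ* FreeSemigroup β := e
  have hij (x : S) : i (j x) = x := e.symm_apply_apply x
  refine ⟨fun x => g (j ∘ x), ?_⟩
  have h := coboundary_precomp (ρ.comp i) j g
  have hρ : (ρ.comp i).comp j = ρ := by
    ext1 x
    simp [hij]
  rw [hρ, hg] at h
  rw [h]
  funext x
  exact congrArg f (funext fun k => hij (x k))

/-- The trivial `S`-module structure on an abelian group. -/
def trivialModule (S A : Type*) [Semigroup S] [AddCommGroup A] : S →ₙ* AddMonoid.End A where
  toFun _ := 1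
  map_mul' _ _ := (one_mul 1).symm

/-- Length is additive, hence a 1-cocycle; with trivial coefficients `∂⁰ = 0`. -/
theorem nontrivial_cohomology_one_of_isFreeSemigroup {S : Type u} [Semigroup S] [Nonempty S]
    (hS : IsFreeSemigroup S) : Nontrivial (Cohomology (trivialModule S (ULift.{u} ℤ)) 1) := by
  obtain ⟨β, ⟨e⟩⟩ := hS
  rw [nontrivial_cohomology_succ_iff]
  refine ⟨fun x => ⟨(e (x 0)).length⟩, ?_, fun g hg => ?_⟩
  · funext x
    apply ULift.ext
    simp [coboundary, trivialModule, Fin.contractNth]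
  · obtain ⟨s⟩ := ‹Nonempty S›
    have h := congrArg ULift.down (congrFun hg fun _ => s)
    simp [coboundary, trivialModule, Subsingleton.elim _ (default : Fin 0 → S)] at h
    have := (e s).length.cast_nonneg (α := ℤ)
    simp [FreeSemigroup.length] at h
    omega

theorem cohomologicalDimension_eq_one_of_isFreeSemigroup {S : Type u} [Semigroup S] [Nonempty S]
    (hS : IsFreeSemigroup S) : cohomologicalDimension S = 1 := by
  refine le_antisymm (iSup₂_le fun n hn => ?_) ?_
  · obtain ⟨A, _, ρ, h⟩ := hn
    match n with
    | 0 => simp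
    | 1 => simp
    | n + 2 =>
      obtain ⟨f, hf, hg⟩ := (nontrivial_cohomology_succ_iff ρ (n + 1)).1 h
      obtain ⟨g, hfg⟩ := exists_coboundary_eq_of_isFreeSemigroup hS ρ f hf
      exact absurd hfg (hg g)
  · exact le_iSup₂_of_le (f := fun (n : ℕ) _ => (n : ℕ∞)) 1
      ⟨_, _, _, nontrivial_cohomology_one_of_isFreeSemigroup hS⟩ le_rfl

/-! ### Freeness when `w` does not overlap itself -/

/-- Two factorizations of an element have a common refinement whenever the left factors are
comparable; such a semigroup, if it is left cancellative and graded, is free. -/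
theorem isFreeSemigroup_of_equidivisible {S : Type u} [Semigroup S] [IsLeftCancelMul S]
    (len : S → ℕ) (len_pos : ∀ x, 0 < len x) (len_mul : ∀ x y, len (x * y) = len x + len y)
    (equidiv : ∀ x y z t : S, x * y = z * t → x = z ∨ (∃ u, x = z * u) ∨ ∃ u, z = x * u) :
    IsFreeSemigroup S := by
  let β := {x : S // ∀ y z, y * z ≠ x}
  let φ : FreeSemigroup β →ₙ* S := FreeSemigroup.lift Subtype.val
  have hφ (b : β) : φ (.of b) = b := rfl
  have hinj : Function.Injective φ := by
    intro x y h
    induction x generalizing y with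
    | ih1 a =>
      induction y with
      | ih1 b => exact congrArg _ (Subtype.ext h)
      | ih2 b y _ _ => exact absurd (h.trans (map_mul φ _ _)).symm (a.2 _ _)
    | ih2 a x _ ih =>
      induction y with
      | ih1 b => exact absurd ((map_mul φ _ _).symm.trans h) (b.2 _ _)
      | ih2 b y _ _ =>
        rw [map_mul, map_mul, hφ, hφ] at h
        rcases equidiv _ _ _ _ h with hab | ⟨u, hu⟩ | ⟨u, hu⟩
        · rw [hab] at h
          rw [Subtype.ext hab, ih (mul_left_cancel h)]
        · exact absurd hu.symm (a.2 _ _)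
        · exact absurd hu.symm (b.2 _ _)
  have hsurj (n : ℕ) : ∀ x, len x = n → ∃ y, φ y = x := by
    induction n using Nat.strong_induction_on with
    | _ n ih =>
      intro x hx
      by_cases hirr : ∀ y z, y * z ≠ x
      · exact ⟨.of ⟨x, hirr⟩, rfl⟩
      · push Not at hirr
        obtain ⟨y, z, rfl⟩ := hirr
        have hlen := len_mul y z
        obtain ⟨y', rfl⟩ := ih _ (by have := len_pos z; omega) y rfl
        obtain ⟨z', rfl⟩ := ih _ (by have := len_pos (φ y'); omega) z rfl
        exact ⟨y' * z', map_mul φ _ _⟩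
  exact ⟨β, ⟨(MulEquiv.ofBijective φ ⟨hinj, fun x => hsurj _ x rfl⟩).symm⟩⟩

section FreeSemigroup

variable {α : Type*}

/-- The word of an element of a free semigroup, as a list. -/
def word (x : FreeSemigroup α) : List α := x.head :: x.tail

theorem word_injective : Function.Injective (word (α := α)) := by
  rintro ⟨a, l⟩ ⟨b, m⟩ h
  simpa [word] using h

@[simp]
theorem word_mul (x y : FreeSemigroup α) : word (x * y) = word x ++ word y := rfl

@[simp]
theorem length_word (x : FreeSemigroup α) : (word x).length = x.length := rfl

theorem length_pos (x : FreeSemigroup α) : 0 < x.length := Nat.succ_pos _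

theorem exists_word_eq {l : List α} (hl : l ≠ []) : ∃ x, word x = l := by
  cases l with
  | nil => exact absurd rfl hl
  | cons a l => exact ⟨⟨a, l⟩, rfl⟩

instance : IsCancelMul (FreeSemigroup α) where
  mul_left_cancel x y z h := by
    have h := congrArg word h
    simpa [word_injective.eq_iff] using h
  mul_right_cancel x y z h := by
    have h := congrArg word h
    simpa [word_injective.eq_iff] using h

theorem equidivisible {x y z t : FreeSemigroup α} (h : x * y = z * t) :
    x = z ∨ (∃ u, x = z * u ∧ t = u * y) ∨ ∃ u, z = x * u ∧ y = u * t := by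
  have h' := congrArg word h
  rw [word_mul, word_mul, List.append_eq_append_iff] at h'
  rcases h' with ⟨l, h1, h2⟩ | ⟨l, h1, h2⟩ <;> rcases eq_or_ne l [] with rfl | hl
  · exact Or.inl (word_injective (by simpa using h1.symm))
  · obtain ⟨u, rfl⟩ := exists_word_eq hl
    exact Or.inr (Or.inr ⟨u, word_injective h1, word_injective h2⟩)
  · exact Or.inl (word_injective (by simpa using h1))
  · obtain ⟨u, rfl⟩ := exists_word_eq hl
    exact Or.inr (Or.inl ⟨u, word_injective h1, word_injective h2⟩)

theorem mem_principalRightIdeal_iff {w x : FreeSemigroup α} :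
    x ∈ principalRightIdeal w ↔ word w <+: word x := by
  constructor
  · rintro (rfl | ⟨y, rfl⟩)
    · exact List.prefix_rfl
    · exact List.prefix_append _ _
  · rintro ⟨l, hl⟩
    rcases eq_or_ne l [] with rfl | hne
    · exact Or.inl (word_injective (by simpa using hl.symm))
    · obtain ⟨y, rfl⟩ := exists_word_eq hne
      exact Or.inr ⟨y, word_injective hl.symm⟩

/-- A word that overlaps with a translate of itself by fewer than `w.length` letters. -/
def IsSelfOverlapping (w : FreeSemigroup α) : Prop :=
  ∃ c d : FreeSemigroup α, w * c = d * w ∧ d.length < w.length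

/-- Both `w` and `u w` are prefixes of `u y`. If `u` is shorter than `w`, then `w` is a prefix of `u
w`, which is a self-overlap. -/
theorem mem_principalRightIdeal_of_mul_mem {w u y : FreeSemigroup α}
    (hw : ¬ IsSelfOverlapping w) (hy : y ∈ principalRightIdeal w)
    (huy : u * y ∈ principalRightIdeal w) : u ∈ principalRightIdeal w := by
  rw [mem_principalRightIdeal_iff] at *
  rcases le_or_gt w.length u.length with hle | hlt
  · exact List.prefix_of_prefix_length_le huy (List.prefix_append _ _) hle
  · have huw : word u ++ word w <+: word (u * y) := by
      rw [word_mul]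
      exact (List.prefix_append_right_inj _).2 hy
    obtain ⟨l, hl⟩ := List.prefix_of_prefix_length_le huy huw (by simp)
    have hne : l ≠ [] := by
      rintro rfl
      have := congrArg List.length hl
      have := length_pos u
      simp at *
      omega
    obtain ⟨c, rfl⟩ := exists_word_eq hne
    exact absurd ⟨c, u, word_injective hl, hlt⟩ hw

end FreeSemigroup

theorem isFreeSemigroup_principalRightIdeal {α : Type u} {w : FreeSemigroup α}
    (hw : ¬ IsSelfOverlapping w) : IsFreeSemigroup (principalRightIdeal w) := by
  have : IsLeftCancelMul (principalRightIdeal w) :=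
    ⟨fun x y z h => Subtype.ext (mul_left_cancel (congrArg Subtype.val h))⟩
  refine isFreeSemigroup_of_equidivisible (fun x => x.1.length) (fun x => length_pos x.1)
    (fun x y => FreeSemigroup.length_mul x.1 y.1) fun x y z t h => ?_
  rcases equidivisible (congrArg Subtype.val h) with h | ⟨u, hx, ht⟩ | ⟨u, hz, hy⟩
  · exact Or.inl (Subtype.ext h)
  · exact Or.inr (Or.inl ⟨⟨u, mem_principalRightIdeal_of_mul_mem hw y.2 (ht ▸ t.2)⟩,
      Subtype.ext hx⟩)
  · exact Or.inr (Or.inr ⟨⟨u, mem_principalRightIdeal_of_mul_mem hw t.2 (hy ▸ y.2)⟩,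
      Subtype.ext hz⟩)

/-! ### A class in degree 2 when `w` overlaps itself -/

/-- The left regular module `ℤ[S]`. -/
noncomputable def regularModule (S : Type*) [Semigroup S] : S →ₙ* AddMonoid.End (S →₀ ℤ) where
  toFun s := Finsupp.mapDomain.addMonoidHom (s * ·)
  map_mul' s t := by
    refine AddMonoidHom.ext fun v => ?_
    simp only [mul_assoc]
    exact Finsupp.mapDomain_comp (g := fun x => s * x) (f := fun x => t * x) (v := v)

theorem regularModule_single {S : Type*} [Semigroup S] (s t : S) (k : ℤ) :
    regularModule S s (Finsupp.single t k) = Finsupp.single (s * t) k := by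
  exact Finsupp.mapDomain_single

theorem regularModule_apply_eq_zero {S : Type*} [Semigroup S] {s t : S} (h : ∀ u, s * u ≠ t)
    (v : S →₀ ℤ) : regularModule S s v t = 0 :=
  Finsupp.mapDomain_of_notMem_range v t (by simpa using h)

/-- If `w` and `q` satisfy two relations `w p = q x` and `w p' = q x'`, and `q` lies in neither
`w S` nor `q S`, then any function invariant under right multiplication that separates `x` from
`x'` gives a nonzero class in `H²(S, ℤ[S])`. -/
theorem nontrivial_cohomology_two {S : Type*} [Semigroup S] (δ : S → ℤ)
    (hδ : ∀ x y, δ (x * y) = δ x) {w q p p' x x' : S} (h : w * p = q * x) (h' : w * p' = q * x')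
    (hwq : w ≠ q) (hw : ∀ u, w * u ≠ q) (hq : ∀ u, q * u ≠ q) (hx : δ x ≠ δ x') :
    Nontrivial (Cohomology (regularModule S) 2) := by
  rw [nontrivial_cohomology_succ_iff]
  refine ⟨fun y => Finsupp.single (y 0) (δ (y 1)), ?_, fun g hg => ?_⟩
  · funext y
    simp [coboundary, Fin.sum_univ_succ, Fin.contractNth, regularModule_single, hδ]
  · have key (s t : S) : regularModule S s (g fun _ => t) q - g (fun _ => s * t) q
        + g (fun _ => s) q = Finsupp.single s (δ t) q := by
      have := DFunLike.congr_fun (congrFun hg ![s, t]) q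
      have hc : Fin.contractNth 0 (· * ·) ![s, t] = fun _ => s * t := by
        funext i
        fin_cases i
        rfl
      have hl : (fun i : Fin 1 => ![s, t] i.castSucc) = fun _ => s := by
        funext i
        fin_cases i
        rfl
      simpa [coboundary, hc, hl, sub_eq_add_neg] using this
    -- At the coefficient of `q`, the first two give `g (w p) = g w = g (w p')`, the last two `g (q
    -- x) = g q - δ x` and `g (q x') = g q - δ x'`.
    have h1 := key w p
    have h2 := key w p'
    have h3 := key q x
    have h4 := key q x'
    rw [regularModule_apply_eq_zero hw, Finsupp.single_eq_of_ne (Ne.symm hwq)] at h1 h2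
    rw [regularModule_apply_eq_zero hq, Finsupp.single_eq_same] at h3 h4
    rw [h] at h1
    rw [h'] at h2
    exact hx (by linarith)

theorem nontrivial_cohomology_two_principalRightIdeal {α : Type u} [Nontrivial α]
    {w : FreeSemigroup α} (hw : IsSelfOverlapping w) :
    Nontrivial (Cohomology (regularModule (principalRightIdeal w)) 2) := by
  classical
  obtain ⟨c, d, hcd, hlt⟩ := hw
  obtain ⟨z, hz⟩ := exists_ne w.head
  have hmem (y) : w * y ∈ principalRightIdeal w := Or.inr ⟨y, rfl⟩
  have hdpos := length_pos d
  have hdrop (l : List α) : (word w ++ l).drop w.length = l := List.drop_left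
  have hdrop' : (word w).drop w.length = [] := List.drop_length
  -- The relations are `w · wc = wd · w` and `w · wcz = wd · wz`. The function asks whether the
  -- letter after the initial `w` is `z`; since `z` is not the first letter of `w`, multiplying `w`
  -- by an element of `R` does not change the answer.
  refine nontrivial_cohomology_two
    (fun x => if ((word x.1).drop w.length).head? = some z then 1 else 0) (fun x y => ?_)
    (w := ⟨w, Or.inl rfl⟩) (q := ⟨w * d, hmem d⟩) (p := ⟨w * c, hmem c⟩)
    (p' := ⟨w * (c * .of z), hmem _⟩) (x := ⟨w, Or.inl rfl⟩) (x' := ⟨w * .of z, hmem _⟩)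
    ?_ ?_ ?_ ?_ ?_ ?_
  · obtain ⟨x, hx⟩ := x
    obtain ⟨y, hy⟩ := y
    rcases hx with rfl | ⟨u, rfl⟩
    · have hy' : (word y).head? ≠ some z := by
        rcases hy with rfl | ⟨v, rfl⟩ <;> simpa [word] using Ne.symm hz
      simp [hdrop, hdrop', hy']
    · have hu : (word u).head? = some u.head := rfl
      simp [hdrop, hu]
  · exact Subtype.ext (by simp [mul_assoc, hcd])
  · refine Subtype.ext ?_
    change w * (w * (c * .of z)) = w * d * (w * .of z)
    rw [← mul_assoc w c, hcd]
    simp only [mul_assoc]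
  · intro h
    have := congrArg (fun x => x.1.length) h
    simp at this
    omega
  -- Cancelling `w` would put `d` in `R`, but `d` is shorter than `w`.
  · rintro ⟨u, hu⟩ h
    have hud : u = d := mul_left_cancel (congrArg Subtype.val h)
    have := (mem_principalRightIdeal_iff.1 hu).length_le
    rw [hud, length_word, length_word] at this
    omega
  · rintro ⟨u, hu⟩ h
    have := congrArg (fun x => x.1.length) h
    have := length_pos u
    simp at *
    omega
  · have : word (.of z) = [z] := rfl
    simp [hdrop, hdrop', this]

end SemigroupCohomology

theorem proposition6 {α : Type u} [Nontrivial α] (w : FreeSemigroup α) :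
    SemigroupCohomology.cohomologicalDimension
        (SemigroupCohomology.principalRightIdeal w) = 1 ↔
      SemigroupCohomology.IsFreeSemigroup (SemigroupCohomology.principalRightIdeal w) := by
  refine ⟨fun h => SemigroupCohomology.isFreeSemigroup_principalRightIdeal fun hw => ?_,
    fun h => ?_⟩
  · have : (2 : ℕ) ≤ SemigroupCohomology.cohomologicalDimension
        (SemigroupCohomology.principalRightIdeal w) :=
      le_iSup₂_of_le (f := fun (n : ℕ) _ => (n : ℕ∞)) 2
        ⟨_, _, _, SemigroupCohomology.nontrivial_cohomology_two_principalRightIdeal hw⟩ le_rfl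
    rw [h] at this
    exact absurd this (by decide)
  · have : Nonempty (SemigroupCohomology.principalRightIdeal w) := ⟨⟨w, Or.inl rfl⟩⟩
    exact SemigroupCohomology.cohomologicalDimension_eq_one_of_isFreeSemigroup h
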